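/- Let $\alpha\in\mathbb R$, let $U\subset\mathbb C\times\mathbb R$ be open with coordinates $(w,v)$, $w=x+iy$, and let $F=F(w,\overline w,v)$ be a smooth real function on $U$ with \[ (F\cos^2\alpha+F_{vv})F_{w\overline w}-(F_{\overline w}\cos\alpha-iF_{v\overline w})(F_w\cos\alpha+iF_{vw})=4e^{-2v\sin\alpha}. \] Put $4V:=F\cos^2\alpha+F_{vv}$, $2S:=F_w\cos\alpha+iF_{vw}$, $m:=e^{i\alpha}$, and consider the real one-forms \[ e^1=\tfrac12(e^{imv}dw+e^{-i\overline mv}d\overline w),\qquad e^2=\tfrac i2(e^{-i\overline mv}d\overline w-e^{imv}dw),\qquad e^3=V\,dv-\tfrac i2(S\,dw-\overline S\,d\overline w), \] \[ \nu=\frac{\cos\alpha\,(S\,dw+\overline S\,d\overline w)-2i\sin\alpha\,(\overline S\,d\overline w-S\,dw)}{V}-4\sin\alpha\,dv , \] the metric $h=(e^1)^2+(e^2)^2+(e^3)^2$ with orientation $e^1\wedge e^2\wedge e^3$, and the Einstein--Weyl structure $(h,\nu)$, whose Weyl connection $D$ is the torsion-free connection with $D_ih_{jk}=\nu_ih_{jk}$.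 Then $V$ vanishes nowhere on $U$, and: 1. The vector field $W$ which is $h$-dual to $e^3$ generates a shear-free geodesic congruence: $W$ is smooth and nowhere zero, $W^jD_jW^i$ is at each point a multiple of $W^i$, and the symmetric part of $DW$, restricted to the orthogonal complement of $W$, is at each point a multiple of $h$. 2. Its twist and divergence are \[ \ast_h(e^3\wedge de^3)=\frac{\cos\alpha}{V},\qquad \ast_h d\ast_h e^3=-\frac{2\sin\alpha}{V}. \] 3. They are constant multiples of each other: if $\sin\alpha\ne0$ the twist is a constant multiple of the divergence, and if $\cos\alpha\neq0$ the divergence is a constant multiple of the twist. 4. Each of them solves the generalised monopole equation: for $T$ equal to the twist or to the divergence, $T$ is smooth and there is a smooth one-form $\omega$ on $U$ with $\ast_h\big(dT+\tfrac12\nu T\big)=d\omega$. -/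

import Mathlib

open scoped ContDiff

noncomputable section

namespace EW

/-! Tensor calculus in a chart of a three-dimensional space, in components with respect to the
coordinates `(x, y, v)`; the complex coordinate is `w = x + i y`. -/

/-- Points of the chart: `p 0 = x`, `p 1 = y`, `p 2 = v`. -/
abbrev Pt : Type := Fin 3 → ℝ

/-- One-forms, by components. -/
abbrev Form1 : Type := Pt → Fin 3 → ℝ

/-- Two-forms, by components (`σ = ½ σ_{ij} dxⁱ ∧ dxʲ`, `σ_{ij}` skew). -/
abbrev Form2 : Type := Pt → Fin 3 → Fin 3 → ℝ

/-- Three-forms, by components (totally skew). -/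
abbrev Form3 : Type := Pt → Fin 3 → Fin 3 → Fin 3 → ℝ

/-- Vector fields, by components. -/
abbrev VField : Type := Pt → Fin 3 → ℝ

/-- The partial derivative in the `i`-th coordinate. -/
def pd {E : Type*} [NormedAddCommGroup E] [NormedSpace ℝ E] (i : Fin 3) (f : Pt → E) : Pt → E :=
  fun p => fderiv ℝ f p (Pi.single i 1)

/-- Exterior derivative of a function. -/
def d0 (f : Pt → ℝ) : Form1 := fun p i => pd i f p

/-- Exterior derivative of a one-form. -/
def d1 (β : Form1) : Form2 := fun p i j => pd i (fun q => β q j) p - pd j (fun q => β q i) p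

/-- Exterior derivative of a two-form. -/
def d2 (σ : Form2) : Form3 := fun p i j k =>
  pd i (fun q => σ q j k) p + pd j (fun q => σ q k i) p + pd k (fun q => σ q i j) p

/-- Wedge product of a one-form and a two-form. -/
def wedge12 (β : Form1) (σ : Form2) : Form3 := fun p i j k =>
  β p i * σ p j k + β p j * σ p k i + β p k * σ p i j

/-- A coframe `(e¹, e², e³)`: row `a` of `θ p` holds the components of the one-form `eᵃ` at `p`. -/
abbrev Coframe : Type := Pt → Matrix (Fin 3) (Fin 3) ℝ

/-- The metric `h = (e¹)² + (e²)² + (e³)²` for which the coframe is orthonormal. -/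
def metric (θ : Coframe) (p : Pt) : Matrix (Fin 3) (Fin 3) ℝ :=
  Matrix.of fun i j => ∑ a, θ p a i * θ p a j

/-- The inverse metric `h^{ij}`. -/
def invMetric (θ : Coframe) (p : Pt) : Matrix (Fin 3) (Fin 3) ℝ := (metric θ p)⁻¹

/-- The volume form `e¹ ∧ e² ∧ e³`. -/
def vol (θ : Coframe) : Form3 := fun p i j k =>
  Matrix.det (Matrix.of fun a b => θ p a ((![i, j, k] : Fin 3 → Fin 3) b))

/-- Hodge dual of a one-form, `(*β)_{jk} = β^i vol_{ijk}`. -/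
def star1 (θ : Coframe) (β : Form1) : Form2 := fun p j k =>
  ∑ i, ∑ l, invMetric θ p i l * β p l * vol θ p i j k

/-- Hodge dual of a three-form, `*μ = (1/6) μ^{ijk} vol_{ijk}`. -/
def star3 (θ : Coframe) (μ : Form3) : Pt → ℝ := fun p =>
  (1 / 6) * ∑ i, ∑ j, ∑ k, ∑ a, ∑ b, ∑ c,
    invMetric θ p i a * invMetric θ p j b * invMetric θ p k c * μ p a b c * vol θ p i j k

/-- The vector field metrically dual to a one-form, `W^i = h^{ij} β_j`. -/
def sharp (θ : Coframe) (β : Form1) : VField := fun p i => ∑ j, invMetric θ p i j * β p j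

/-- The inner product `h(X, Y)` at `p`. -/
def inner (θ : Coframe) (p : Pt) (X Y : Fin 3 → ℝ) : ℝ := ∑ i, ∑ j, metric θ p i j * X i * Y j

/-- Christoffel symbols `Γ^i_{jk}` of the Levi-Civita connection of `h`. -/
def christoffel (θ : Coframe) (p : Pt) (i j k : Fin 3) : ℝ :=
  (1 / 2) * ∑ l, invMetric θ p i l *
    (pd j (fun q => metric θ q l k) p + pd k (fun q => metric θ q l j) p
      - pd l (fun q => metric θ q j k) p)

/-- `γ^i_{jk} = -δ^i_{(j} ν_{k)} + ½ h_{jk} h^{im} ν_m`, the difference between the Weyl connection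
`D` (torsion-free with `D h = ν ⊗ h`) and the Levi-Civita connection of `h`. -/
def weylDiff (θ : Coframe) (ν : Form1) (p : Pt) (i j k : Fin 3) : ℝ :=
  -(1 / 2) * ((if i = j then ν p k else 0) + (if i = k then ν p j else 0))
    + (1 / 2) * metric θ p j k * ∑ m, invMetric θ p i m * ν p m

/-- The Weyl covariant derivative `D_j W^i` of a vector field. -/
def weylD (θ : Coframe) (ν : Form1) (W : VField) (p : Pt) (j i : Fin 3) : ℝ :=
  pd j (fun q => W q i) p + ∑ k, (christoffel θ p i j k + weylDiff θ ν p i j k) * W p k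

/-- The covariant derivative `D_X W` at `p`. -/
def weylDAlong (θ : Coframe) (ν : Form1) (W : VField) (p : Pt) (X : Fin 3 → ℝ) : Fin 3 → ℝ :=
  fun i => ∑ j, X j * weylD θ ν W p j i

/-- The vector field `W` generates a shear-free geodesic congruence of the Weyl structure `(h, ν)`
in the region `U`: `W` is smooth and nowhere zero, `W^j D_j W^i ∼ W^i`, and the symmetric part of
`D W`, restricted to the orthogonal complement of `W`, is a multiple of the metric. -/
structure IsShearFreeGeodesicCongruence (U : Set Pt) (θ : Coframe) (ν : Form1) (W : VField) :
    Prop where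
  smooth : ContDiffOn ℝ ∞ W U
  ne_zero : ∀ p ∈ U, W p ≠ 0
  geodesic : ∀ p ∈ U, ∃ c : ℝ, weylDAlong θ ν W p (W p) = c • W p
  shear_free : ∀ p ∈ U, ∃ c : ℝ, ∀ X Y : Fin 3 → ℝ,
    inner θ p X (W p) = 0 → inner θ p Y (W p) = 0 →
      inner θ p (weylDAlong θ ν W p X) Y + inner θ p (weylDAlong θ ν W p Y) X = c * inner θ p X Y

/-- `*_h (β ∧ dβ)`. -/
def twist (θ : Coframe) (β : Form1) : Pt → ℝ := star3 θ (wedge12 β (d1 β))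

/-- `*_h d *_h β`. -/
def divergence (θ : Coframe) (β : Form1) : Pt → ℝ := star3 θ (d2 (star1 θ β))

/-- The function `T` solves the generalised monopole equation `*_h (dT + ½ ν T) = dA` in `U`
for some one-form `A`. -/
def SolvesMonopole (U : Set Pt) (θ : Coframe) (ν : Form1) (T : Pt → ℝ) : Prop :=
  ContDiffOn ℝ ∞ T U ∧ ∃ A : Form1, ContDiffOn ℝ ∞ A U ∧
    ∀ p ∈ U, star1 θ (fun q i => d0 T q i + (1 / 2) * ν q i * T q) p = d1 A p

/-! The Einstein-Weyl structures given by a real function `F(w, w̄, v)` and a real constant `α`. -/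

/-- `∂f/∂w`. -/
def pw (f : Pt → ℂ) : Pt → ℂ := fun p => (pd 0 f p - Complex.I * pd 1 f p) / 2

/-- `∂f/∂w̄`. -/
def pwbar (f : Pt → ℂ) : Pt → ℂ := fun p => (pd 0 f p + Complex.I * pd 1 f p) / 2

/-- A real function, regarded as complex valued. -/
def toC (F : Pt → ℝ) : Pt → ℂ := fun p => (F p : ℂ)

/-- `(F cos²α + F_vv) F_{ww̄} - (F_w̄ cos α - i F_{vw̄}) (F_w cos α + i F_{vw}) = 4 e^{-2 v sin α}`
at `p`. -/
def FieldEquation (α : ℝ) (F : Pt → ℝ) (p : Pt) : Prop :=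
  ((F p * Real.cos α ^ 2 + pd 2 (pd 2 F) p : ℝ) : ℂ) * pw (pwbar (toC F)) p
    - (pwbar (toC F) p * (Real.cos α : ℂ) - Complex.I * pwbar (pd 2 (toC F)) p)
      * (pw (toC F) p * (Real.cos α : ℂ) + Complex.I * pw (pd 2 (toC F)) p)
    = ((4 * Real.exp (-2 * p 2 * Real.sin α) : ℝ) : ℂ)

/-- `4 V = F cos²α + F_vv`. -/
def V (α : ℝ) (F : Pt → ℝ) : Pt → ℝ := fun p => (F p * Real.cos α ^ 2 + pd 2 (pd 2 F) p) / 4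

/-- `2 S = F_w cos α + i F_{vw}`. -/
def S (α : ℝ) (F : Pt → ℝ) : Pt → ℂ := fun p =>
  (pw (toC F) p * (Real.cos α : ℂ) + Complex.I * pw (pd 2 (toC F)) p) / 2

/-- Components of `dw`. -/
def dw : Fin 3 → ℂ := ![1, Complex.I, 0]

/-- Components of `dw̄`. -/
def dwbar : Fin 3 → ℂ := ![1, -Complex.I, 0]

/-- Components of `dv`. -/
def dv : Fin 3 → ℂ := ![0, 0, 1]

/-- The constant `m = e^{iα}`. -/
def m (α : ℝ) : ℂ := Complex.exp (Complex.I * (α : ℂ))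

/-- `e¹ = ½ (e^{imv} dw + e^{-im̄v} dw̄)`; the expression equals its conjugate, so that taking the
real part only changes its type (likewise in the next three definitions). -/
def e1 (α : ℝ) : Form1 := fun p j =>
  ((1 / 2) * (Complex.exp (Complex.I * m α * (p 2 : ℂ)) * dw j
    + Complex.exp (-Complex.I * star (m α) * (p 2 : ℂ)) * dwbar j)).re

/-- `e² = (i/2) (e^{-im̄v} dw̄ - e^{imv} dw)`. -/
def e2 (α : ℝ) : Form1 := fun p j =>
  ((Complex.I / 2) * (Complex.exp (-Complex.I * star (m α) * (p 2 : ℂ)) * dwbar j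
    - Complex.exp (Complex.I * m α * (p 2 : ℂ)) * dw j)).re

/-- `e³ = V dv - (i/2) (S dw - S̄ dw̄)`. -/
def e3 (α : ℝ) (F : Pt → ℝ) : Form1 := fun p j =>
  ((V α F p : ℂ) * dv j - (Complex.I / 2) * (S α F p * dw j - star (S α F p) * dwbar j)).re

/-- `ν = (cos α (S dw + S̄ dw̄) - 2 i sin α (S̄ dw̄ - S dw)) / V - 4 sin α dv`. -/
def nu (α : ℝ) (F : Pt → ℝ) : Form1 := fun p j =>
  (((Real.cos α : ℂ) * (S α F p * dw j + star (S α F p) * dwbar j)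
      - 2 * Complex.I * (Real.sin α : ℂ) * (star (S α F p) * dwbar j - S α F p * dw j))
      / (V α F p : ℂ)
    - 4 * (Real.sin α : ℂ) * dv j).re

/-- The orthonormal coframe `(e¹, e², e³)`; its metric is
`h = e^{-2 v sin α} dw dw̄ + (V dv - (i/2) (S dw - S̄ dw̄))²`. -/
def coframe (α : ℝ) (F : Pt → ℝ) : Coframe := fun p => Matrix.of ![e1 α p, e2 α p, e3 α F p]

end EW

end

/-! Write a = Re S, b = Im S, L = F_{ww̄} and E = e^{-2v sin α}. In real coordinates e³ = b dx + a
dy + V dv and h = E(dx² + dy²) + (e³)². The field equation becomes V L - (a² + b²) = E, so V cannot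
vanish because E > 0, and the field dual to e³ is W = V⁻¹ ∂_v.

Since V, a, b and L are all built from derivatives of F, commuting partial derivatives gives four
linear identities: `pd_one_V`, `pd_zero_V`, `pd_zero_Sre`, `pd_one_Sre`. The first three compute
de³, which is cos α times an expression without derivatives of V and S; wedging with e³ produces cos
α (V L - |S|²) = cos α E, hence the twist. The divergence is simpler: *e³ = E dx ∧ dy, and only ∂_v
E = -2 E sin α enters. Both are thus constants over V, so one computation for k/V
(`solvesMonopole_of_eq_div`) settles the monopole equation, with an explicit potential. Its dx ∧ dy
component is the only place where the v-derivative of the field equation is needed.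

For the congruence, D W is computed with its upper index lowered (`sum_metric_mul_weylD`). On the
complement of W the symmetric part sees only ∂_v E and ν(∂_v), both pure trace; the geodesic
property follows from the identities for V_x and V_y. -/

namespace EW

/-! ### Rules for partial derivatives. -/

section Calculus

theorem pd_congr {E : Type*} [NormedAddCommGroup E] [NormedSpace ℝ E] {f g : Pt → E} {p : Pt}
    (h : f =ᶠ[nhds p] g) (i : Fin 3) : pd i f p = pd i g p := by
  unfold pd; rw [h.fderiv_eq]

theorem pd_const (i : Fin 3) (c : ℝ) (p : Pt) : pd i (fun _ => c) p = 0 := by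
  simp [pd]

theorem pd_add {f g : Pt → ℝ} {p : Pt} (hf : DifferentiableAt ℝ f p) (hg : DifferentiableAt ℝ g p)
    (i : Fin 3) : pd i (fun q => f q + g q) p = pd i f p + pd i g p := by
  simp [pd, fderiv_fun_add hf hg]

theorem pd_sub {f g : Pt → ℝ} {p : Pt} (hf : DifferentiableAt ℝ f p) (hg : DifferentiableAt ℝ g p)
    (i : Fin 3) : pd i (fun q => f q - g q) p = pd i f p - pd i g p := by
  simp [pd, fderiv_fun_sub hf hg]

theorem pd_mul {f g : Pt → ℝ} {p : Pt} (hf : DifferentiableAt ℝ f p) (hg : DifferentiableAt ℝ g p)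
    (i : Fin 3) : pd i (fun q => f q * g q) p = pd i f p * g p + f p * pd i g p := by
  simp [pd, fderiv_fun_mul hf hg]; ring

theorem pd_const_mul {g : Pt → ℝ} {p : Pt} (hg : DifferentiableAt ℝ g p) (c : ℝ)
    (i : Fin 3) : pd i (fun q => c * g q) p = c * pd i g p := by
  simp [pd, fderiv_const_mul hg]

theorem pd_sq {f : Pt → ℝ} {p : Pt} (hf : DifferentiableAt ℝ f p)
    (i : Fin 3) : pd i (fun q => f q ^ 2) p = 2 * f p * pd i f p := by
  simp only [pow_two]; rw [pd_mul hf hf]; ring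

theorem pd_inv {g : Pt → ℝ} {p : Pt} (hg : DifferentiableAt ℝ g p) (h0 : g p ≠ 0) (i : Fin 3) :
    pd i (fun q => (g q)⁻¹) p = -pd i g p / g p ^ 2 := by
  have h := ((hasDerivAt_inv h0).comp_hasFDerivAt p hg.hasFDerivAt).fderiv
  unfold pd
  erw [h]
  simp
  ring

theorem pd_div {f g : Pt → ℝ} {p : Pt} (hf : DifferentiableAt ℝ f p) (hg : DifferentiableAt ℝ g p)
    (h0 : g p ≠ 0) (i : Fin 3) :
    pd i (fun q => f q / g q) p = (pd i f p * g p - f p * pd i g p) / g p ^ 2 := by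
  simp only [div_eq_mul_inv]
  rw [pd_mul hf (hg.fun_inv h0), pd_inv hg h0]
  field_simp
  ring

theorem contDiffOn_pd {E : Type*} [NormedAddCommGroup E] [NormedSpace ℝ E] {U : Set Pt}
    (hU : IsOpen U) {f : Pt → E} (hf : ContDiffOn ℝ ∞ f U) (i : Fin 3) :
    ContDiffOn ℝ ∞ (pd i f) U :=
  (hf.fderiv_of_isOpen hU (by simp)).clm_apply contDiffOn_const

theorem two_le_infty : (2 : WithTop ℕ∞) ≤ ∞ := WithTop.coe_le_coe.2 le_top

theorem pd_comm {f : Pt → ℝ} {p : Pt} (hf : ContDiffAt ℝ ∞ f p) (i j : Fin 3) :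
    pd i (pd j f) p = pd j (pd i f) p := by
  have hs : IsSymmSndFDerivAt ℝ f p := hf.isSymmSndFDerivAt (by simpa using two_le_infty)
  have hd : DifferentiableAt ℝ (fderiv ℝ f) p :=
    (hf.fderiv_right (m := 1) (by simpa [one_add_one_eq_two] using two_le_infty)).differentiableAt (by simp)
  have key : ∀ i j : Fin 3, pd i (pd j f) p =
      fderiv ℝ (fderiv ℝ f) p (Pi.single i 1) (Pi.single j 1) := by
    intro i j
    unfold pd
    rw [fderiv_clm_apply hd (by fun_prop)]
    simp
  rw [key, key]
  exact hs _ _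

theorem pd_toC {f : Pt → ℝ} {p : Pt} (hf : DifferentiableAt ℝ f p) (i : Fin 3) :
    pd i (toC f) p = ((pd i f p : ℝ) : ℂ) := by
  have h := (Complex.ofRealCLM.hasFDerivAt.comp p hf.hasFDerivAt).fderiv
  unfold pd toC
  erw [h]
  simp

end Calculus

/-! ### The coframe, metric and volume form in real components. -/

section Algebra

/-- The conformal factor `e^{-2 v sin α}`. -/
noncomputable def conf (α : ℝ) : Pt → ℝ := fun p => Real.exp (-2 * p 2 * Real.sin α)

theorem conf_pos (α : ℝ) (p : Pt) : 0 < conf α p := Real.exp_pos _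

theorem differentiable_conf (α : ℝ) : Differentiable ℝ (conf α) := by
  unfold conf; fun_prop

theorem pd_conf (α : ℝ) (p : Pt) (i : Fin 3) :
    pd i (conf α) p = if i = 2 then -2 * Real.sin α * conf α p else 0 := by
  have h2 : HasFDerivAt (fun q : Pt => q 2) (ContinuousLinearMap.proj (R := ℝ) 2) p :=
    (ContinuousLinearMap.proj (R := ℝ) (φ := fun _ : Fin 3 => ℝ) 2).hasFDerivAt
  have h := (((h2.const_mul (-2)).mul_const (Real.sin α)).exp).fderiv
  unfold pd conf
  rw [h]
  fin_cases i <;> simp 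
  ring

/-- The real part of `S`. -/
noncomputable def Sre (α : ℝ) (F : Pt → ℝ) : Pt → ℝ := fun p => (S α F p).re

/-- The imaginary part of `S`. -/
noncomputable def Sim (α : ℝ) (F : Pt → ℝ) : Pt → ℝ := fun p => (S α F p).im

/-- Since e¹ + i e² = e^{imv} dw, this modulus and phase exhibit (e¹, e²) as (dx, dy) scaled by
e^{-v sin α} and rotated by v cos α. The rotation drops out of the metric and the volume form. -/
theorem exp_I_m (α v : ℝ) : Complex.exp (Complex.I * m α * (v : ℂ)) =
    ((Real.exp (-v * Real.sin α) * Real.cos (v * Real.cos α) : ℝ) : ℂ) +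
    ((Real.exp (-v * Real.sin α) * Real.sin (v * Real.cos α) : ℝ) : ℂ) * Complex.I := by
  have hm : m α = (Real.cos α : ℂ) + (Real.sin α : ℂ) * Complex.I := by
    unfold m; rw [mul_comm, Complex.exp_mul_I]; push_cast; rfl
  have h : Complex.I * m α * (v : ℂ) =
      ((-v * Real.sin α : ℝ) : ℂ) + ((v * Real.cos α : ℝ) : ℂ) * Complex.I := by
    rw [hm]; push_cast; linear_combination ((v : ℂ) * Complex.sin α) * Complex.I_sq
  rw [h, Complex.exp_add, Complex.exp_mul_I, ← Complex.ofReal_exp, ← Complex.ofReal_cos,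
    ← Complex.ofReal_sin, Complex.ofReal_mul, Complex.ofReal_mul]
  ring

theorem exp_neg_I_star_m (α v : ℝ) : Complex.exp (-Complex.I * star (m α) * (v : ℂ)) =
    star (Complex.exp (Complex.I * m α * (v : ℂ))) := by
  simp [← Complex.exp_conj]

theorem e1_eq (α : ℝ) (p : Pt) : e1 α p =
    ![Real.exp (-p 2 * Real.sin α) * Real.cos (p 2 * Real.cos α),
      -(Real.exp (-p 2 * Real.sin α) * Real.sin (p 2 * Real.cos α)), 0] := by
  funext j
  unfold e1
  rw [exp_neg_I_star_m, exp_I_m]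
  generalize Real.exp (-p 2 * Real.sin α) * Real.cos (p 2 * Real.cos α) = c
  generalize Real.exp (-p 2 * Real.sin α) * Real.sin (p 2 * Real.cos α) = s
  fin_cases j <;> simp [dw, dwbar] <;> ring

theorem e2_eq (α : ℝ) (p : Pt) : e2 α p =
    ![Real.exp (-p 2 * Real.sin α) * Real.sin (p 2 * Real.cos α),
      Real.exp (-p 2 * Real.sin α) * Real.cos (p 2 * Real.cos α), 0] := by
  funext j
  unfold e2
  rw [exp_neg_I_star_m, exp_I_m]
  generalize Real.exp (-p 2 * Real.sin α) * Real.cos (p 2 * Real.cos α) = c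
  generalize Real.exp (-p 2 * Real.sin α) * Real.sin (p 2 * Real.cos α) = s
  fin_cases j <;> simp [dw, dwbar] <;> ring

theorem e3_eq (α : ℝ) (F : Pt → ℝ) (p : Pt) :
    e3 α F p = ![Sim α F p, Sre α F p, V α F p] := by
  funext j
  unfold e3 Sim Sre
  fin_cases j <;> simp [dw, dwbar, dv] <;> ring

theorem nu_eq (α : ℝ) (F : Pt → ℝ) (p : Pt) : nu α F p =
    ![(2 * Real.cos α * Sre α F p - 4 * Real.sin α * Sim α F p) / V α F p,
      (-2 * Real.cos α * Sim α F p - 4 * Real.sin α * Sre α F p) / V α F p,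
      -4 * Real.sin α] := by
  funext j
  unfold nu Sim Sre
  fin_cases j <;>
    simp [dw, dwbar, dv, Complex.div_ofReal_re, -Complex.ofReal_cos, -Complex.ofReal_sin] <;> ring

theorem exp_sq_eq_conf (α : ℝ) (p : Pt) : Real.exp (-p 2 * Real.sin α) ^ 2 = conf α p := by
  unfold conf; rw [← Real.exp_nat_mul]; push_cast; ring_nf

theorem metric_eq (α : ℝ) (F : Pt → ℝ) (p : Pt) : metric (coframe α F) p =
    !![conf α p + Sim α F p ^ 2, Sim α F p * Sre α F p, Sim α F p * V α F p;
       Sim α F p * Sre α F p, conf α p + Sre α F p ^ 2, Sre α F p * V α F p;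
       Sim α F p * V α F p, Sre α F p * V α F p, V α F p ^ 2] := by
  have h := Real.sin_sq_add_cos_sq (p 2 * Real.cos α)
  ext i j
  unfold metric coframe
  rw [← exp_sq_eq_conf]
  fin_cases i <;> fin_cases j <;>
    simp [Fin.sum_univ_three, e1_eq, e2_eq, e3_eq, -neg_mul] <;>
    first | ring1 | linear_combination Real.exp (-p 2 * Real.sin α) ^ 2 * h

theorem vol_eq (α : ℝ) (F : Pt → ℝ) (p : Pt) : vol (coframe α F) p 0 1 2 =
    conf α p * V α F p := by
  have h := Real.sin_sq_add_cos_sq (p 2 * Real.cos α)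
  unfold vol coframe
  rw [← exp_sq_eq_conf, Matrix.det_fin_three]
  simp [e1_eq, e2_eq, e3_eq, -neg_mul]
  linear_combination (Real.exp (-p 2 * Real.sin α) ^ 2 * V α F p) * h

theorem metric_mul_eq_one (α : ℝ) (F : Pt → ℝ) {p : Pt} (hV : V α F p ≠ 0) :
    metric (coframe α F) p *
    !![1 / conf α p, 0, -Sim α F p / (conf α p * V α F p);
       0, 1 / conf α p, -Sre α F p / (conf α p * V α F p);
       -Sim α F p / (conf α p * V α F p), -Sre α F p / (conf α p * V α F p),
        (Sim α F p ^ 2 + Sre α F p ^ 2 + conf α p) / (conf α p * V α F p ^ 2)] = 1 := by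
  have hE := (conf_pos α p).ne'
  rw [metric_eq]
  ext i j
  fin_cases i <;> fin_cases j <;>
    simp [Matrix.mul_apply, Fin.sum_univ_three] <;> field_simp <;> ring

theorem invMetric_eq (α : ℝ) (F : Pt → ℝ) {p : Pt} (hV : V α F p ≠ 0) :
    invMetric (coframe α F) p =
    !![1 / conf α p, 0, -Sim α F p / (conf α p * V α F p);
       0, 1 / conf α p, -Sre α F p / (conf α p * V α F p);
       -Sim α F p / (conf α p * V α F p), -Sre α F p / (conf α p * V α F p),
        (Sim α F p ^ 2 + Sre α F p ^ 2 + conf α p) / (conf α p * V α F p ^ 2)] :=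
  Matrix.inv_eq_right_inv (metric_mul_eq_one α F hV)

theorem metric_mul_invMetric (α : ℝ) (F : Pt → ℝ) {p : Pt} (hV : V α F p ≠ 0) :
    metric (coframe α F) p * invMetric (coframe α F) p = 1 := by
  rw [invMetric_eq α F hV, metric_mul_eq_one α F hV]

theorem vol_skew₁ (θ : Coframe) (p : Pt) (i j k : Fin 3) : vol θ p i j k = - vol θ p j i k := by
  unfold vol
  simp only [Matrix.det_fin_three, Matrix.of_apply, Matrix.cons_val]
  ring

theorem vol_skew₂ (θ : Coframe) (p : Pt) (i j k : Fin 3) : vol θ p i j k = - vol θ p i k j := by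
  unfold vol
  simp only [Matrix.det_fin_three, Matrix.of_apply, Matrix.cons_val]
  ring

/-- A totally skew array of rank three in dimension three is determined by one component. -/
theorem skew_eq {μ : Fin 3 → Fin 3 → Fin 3 → ℝ} (h₁ : ∀ i j k, μ i j k = - μ j i k)
    (h₂ : ∀ i j k, μ i j k = - μ i k j) :
    μ = fun i j k => μ 0 1 2 * (![![![0, 0, 0], ![0, 0, 1], ![0, -1, 0]],
      ![![0, 0, -1], ![0, 0, 0], ![1, 0, 0]], ![![0, 1, 0], ![-1, 0, 0], ![0, 0, 0]]] :
        Fin 3 → Fin 3 → Fin 3 → ℝ) i j k := by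
  have a : ∀ i k, μ i i k = 0 := fun i k => by linarith [h₁ i i k]
  have b : ∀ i k, μ i k k = 0 := fun i k => by linarith [h₂ i k k]
  have c : ∀ i k, μ i k i = 0 := fun i k => by linarith [h₂ i k i, a i k]
  funext i j k
  fin_cases i <;> fin_cases j <;> fin_cases k <;> simp [a, b, c] <;>
    linarith [h₁ 1 0 2, h₂ 0 2 1, h₂ 1 2 0, h₁ 2 0 1, h₂ 2 1 0, h₁ 1 2 0]

/-- Both `μ` and the volume form are multiples of the permutation symbol, so contracting with three
inverse metrics gives 6 times a determinant, which cancels the 1/6. -/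
theorem star3_eq {θ : Coframe} {μ : Form3} {p : Pt} (h₁ : ∀ i j k, μ p i j k = - μ p j i k)
    (h₂ : ∀ i j k, μ p i j k = - μ p i k j) :
    star3 θ μ p = (invMetric θ p).det * vol θ p 0 1 2 * μ p 0 1 2 := by
  have hv := skew_eq (vol_skew₁ θ p) (vol_skew₂ θ p)
  have hm := skew_eq h₁ h₂
  unfold star3
  rw [hv, hm, Matrix.det_fin_three]
  simp [Fin.sum_univ_three]
  ring

end Algebra

/-! ### The field equation and the differential identities satisfied by V, S and F_{ww̄}. -/

section FieldData

theorem pd_half_add_I_mul {f g : Pt → ℝ} {p : Pt} (hf : DifferentiableAt ℝ f p)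
    (hg : DifferentiableAt ℝ g p) (i : Fin 3) :
    pd i (fun q => ((f q : ℂ) + Complex.I * (g q : ℂ)) / 2) p =
      ((pd i f p : ℝ) + Complex.I * (pd i g p : ℝ)) / 2 := by
  have h1 : HasFDerivAt (fun q => (f q : ℂ)) (Complex.ofRealCLM ∘L fderiv ℝ f p) p :=
    Complex.ofRealCLM.hasFDerivAt.comp p hf.hasFDerivAt
  have h2 : HasFDerivAt (fun q => (g q : ℂ)) (Complex.ofRealCLM ∘L fderiv ℝ g p) p :=
    Complex.ofRealCLM.hasFDerivAt.comp p hg.hasFDerivAt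
  have h := ((h1.add (h2.const_mul Complex.I)).mul_const (2⁻¹ : ℂ)).fderiv
  simp only [div_eq_mul_inv]
  unfold pd
  erw [h]
  simp
  ring

variable {α : ℝ} {U : Set Pt} {F : Pt → ℝ}

theorem differentiableAt_of_contDiffOn (hU : IsOpen U) {f : Pt → ℝ} (hf : ContDiffOn ℝ ∞ f U)
    {p : Pt} (hp : p ∈ U) : DifferentiableAt ℝ f p :=
  (hf.contDiffAt (hU.mem_nhds hp)).differentiableAt (by simp)

theorem pd_toC_eventuallyEq (hU : IsOpen U) (hF : ContDiffOn ℝ ∞ F U) {p : Pt} (hp : p ∈ U)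
    (i : Fin 3) : pd i (toC F) =ᶠ[nhds p] toC (pd i F) := by
  filter_upwards [hU.mem_nhds hp] with q hq
  rw [pd_toC (differentiableAt_of_contDiffOn hU hF hq)]
  rfl

theorem S_eq (hU : IsOpen U) (hF : ContDiffOn ℝ ∞ F U) {p : Pt} (hp : p ∈ U) :
    S α F p = (((Real.cos α * pd 0 F p + pd 1 (pd 2 F) p) / 4 : ℝ) : ℂ) +
      (((pd 0 (pd 2 F) p - Real.cos α * pd 1 F p) / 4 : ℝ) : ℂ) * Complex.I := by
  have hF2 := differentiableAt_of_contDiffOn hU (contDiffOn_pd hU hF 2) hp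
  have hF0 := differentiableAt_of_contDiffOn hU hF hp
  unfold S pw
  rw [pd_congr (pd_toC_eventuallyEq hU hF hp 2) 0, pd_congr (pd_toC_eventuallyEq hU hF hp 2) 1,
    pd_toC hF2, pd_toC hF2, pd_toC hF0, pd_toC hF0]
  push_cast
  linear_combination (-((pd 1 (pd 2 F) p : ℝ) : ℂ) / 4) * Complex.I_sq

theorem Sre_eq (hU : IsOpen U) (hF : ContDiffOn ℝ ∞ F U) {p : Pt} (hp : p ∈ U) :
    Sre α F p = (Real.cos α * pd 0 F p + pd 1 (pd 2 F) p) / 4 := by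
  rw [Sre, S_eq hU hF hp]
  simp only [Complex.add_re, Complex.re_ofReal_mul, Complex.ofReal_re, Complex.I_re]
  ring

theorem Sim_eq (hU : IsOpen U) (hF : ContDiffOn ℝ ∞ F U) {p : Pt} (hp : p ∈ U) :
    Sim α F p = (pd 0 (pd 2 F) p - Real.cos α * pd 1 F p) / 4 := by
  rw [Sim, S_eq hU hF hp]
  simp only [Complex.add_im, Complex.im_ofReal_mul, Complex.ofReal_im, Complex.I_im]
  ring

/-- `F_{ww̄}`, a quarter of the Laplacian of `F` in the `(x, y)`-plane. -/
noncomputable def quarterLaplacian (F : Pt → ℝ) : Pt → ℝ :=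
  fun p => (pd 0 (pd 0 F) p + pd 1 (pd 1 F) p) / 4

theorem pw_pwbar (hU : IsOpen U) (hF : ContDiffOn ℝ ∞ F U) {p : Pt} (hp : p ∈ U) :
    pw (pwbar (toC F)) p = (quarterLaplacian F p : ℂ) := by
  have h : pwbar (toC F) =ᶠ[nhds p]
      fun q => (((pd 0 F q : ℝ) : ℂ) + Complex.I * ((pd 1 F q : ℝ) : ℂ)) / 2 := by
    filter_upwards [pd_toC_eventuallyEq hU hF hp 0, pd_toC_eventuallyEq hU hF hp 1] with q h0 h1
    simp only [pwbar, h0, h1, toC]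
  have hd : ∀ i, DifferentiableAt ℝ (pd i F) p := fun i =>
    differentiableAt_of_contDiffOn hU (contDiffOn_pd hU hF i) hp
  have hc := pd_comm (hF.contDiffAt (hU.mem_nhds hp)) 0 1
  unfold pw quarterLaplacian
  rw [pd_congr h, pd_congr h, pd_half_add_I_mul (hd 0) (hd 1), pd_half_add_I_mul (hd 0) (hd 1), hc]
  push_cast
  linear_combination (-((pd 1 (pd 1 F) p : ℝ) : ℂ) / 4) * Complex.I_sq

/-- The two factors of the product in the field equation are 2S̄ and 2S, so it equals 4|S|²;
dividing the real part by 4 leaves this form. -/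
theorem field_eq (hU : IsOpen U) (hF : ContDiffOn ℝ ∞ F U) {p : Pt} (hp : p ∈ U)
    (hEq : FieldEquation α F p) :
    V α F p * quarterLaplacian F p - (Sre α F p ^ 2 + Sim α F p ^ 2) = conf α p := by
  have hF2 := differentiableAt_of_contDiffOn hU (contDiffOn_pd hU hF 2) hp
  have hF0 := differentiableAt_of_contDiffOn hU hF hp
  unfold FieldEquation at hEq
  rw [pw_pwbar hU hF hp] at hEq
  unfold pw pwbar at hEq
  rw [pd_congr (pd_toC_eventuallyEq hU hF hp 2) 0, pd_congr (pd_toC_eventuallyEq hU hF hp 2) 1,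
    pd_toC hF2, pd_toC hF2, pd_toC hF0, pd_toC hF0] at hEq
  have h := congrArg Complex.re hEq
  rw [Sre_eq hU hF hp, Sim_eq hU hF hp]
  unfold V conf
  simp [pow_two, -Complex.ofReal_cos, -Complex.ofReal_sin, -Complex.ofReal_exp, Complex.div_ofNat_re,
    Complex.div_ofNat_im, Complex.ofReal_re, Complex.ofReal_im] at h
  rw [show -2 * p 2 * Real.sin α = -(2 * p 2 * Real.sin α) by ring]
  linear_combination h / 4

theorem contDiffOn_V (hU : IsOpen U) (hF : ContDiffOn ℝ ∞ F U) : ContDiffOn ℝ ∞ (V α F) U :=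
  ((hF.mul contDiffOn_const).add (contDiffOn_pd hU (contDiffOn_pd hU hF 2) 2)).div_const 4

theorem contDiffOn_Sre (hU : IsOpen U) (hF : ContDiffOn ℝ ∞ F U) : ContDiffOn ℝ ∞ (Sre α F) U :=
  (((contDiffOn_const.mul (contDiffOn_pd hU hF 0)).add
    (contDiffOn_pd hU (contDiffOn_pd hU hF 2) 1)).div_const 4).congr fun _ hp => Sre_eq hU hF hp

theorem contDiffOn_Sim (hU : IsOpen U) (hF : ContDiffOn ℝ ∞ F U) : ContDiffOn ℝ ∞ (Sim α F) U :=
  (((contDiffOn_pd hU (contDiffOn_pd hU hF 2) 0).sub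
    (contDiffOn_const.mul (contDiffOn_pd hU hF 1))).div_const 4).congr fun _ hp => Sim_eq hU hF hp

theorem contDiffOn_quarterLaplacian (hU : IsOpen U) (hF : ContDiffOn ℝ ∞ F U) :
    ContDiffOn ℝ ∞ (quarterLaplacian F) U :=
  ((contDiffOn_pd hU (contDiffOn_pd hU hF 0) 0).add
    (contDiffOn_pd hU (contDiffOn_pd hU hF 1) 1)).div_const 4

theorem V_ne_zero (hU : IsOpen U) (hF : ContDiffOn ℝ ∞ F U) {p : Pt} (hp : p ∈ U)
    (hEq : FieldEquation α F p) : V α F p ≠ 0 := by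
  intro h
  have h1 := field_eq hU hF hp hEq
  rw [h] at h1
  nlinarith [conf_pos α p, sq_nonneg (Sre α F p), sq_nonneg (Sim α F p)]

theorem pd_div_const {f : Pt → ℝ} {p : Pt} (hf : DifferentiableAt ℝ f p) (c : ℝ) (i : Fin 3) :
    pd i (fun q => f q / c) p = pd i f p / c := by
  simp only [div_eq_inv_mul]
  exact pd_const_mul hf _ i

theorem pd_V (hU : IsOpen U) (hF : ContDiffOn ℝ ∞ F U) {p : Pt} (hp : p ∈ U) (i : Fin 3) :
    pd i (V α F) p = (Real.cos α ^ 2 * pd i F p + pd i (pd 2 (pd 2 F)) p) / 4 := by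
  have hF0 := differentiableAt_of_contDiffOn hU hF hp
  have hF2 := differentiableAt_of_contDiffOn hU (contDiffOn_pd hU (contDiffOn_pd hU hF 2) 2) hp
  unfold V
  simp only [mul_comm (F _)]
  rw [pd_div_const ((hF0.const_mul _).fun_add hF2), pd_add (hF0.const_mul _) hF2, pd_const_mul hF0]

theorem pd_Sre (hU : IsOpen U) (hF : ContDiffOn ℝ ∞ F U) {p : Pt} (hp : p ∈ U) (i : Fin 3) :
    pd i (Sre α F) p = (Real.cos α * pd i (pd 0 F) p + pd i (pd 1 (pd 2 F)) p) / 4 := by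
  have h0 := differentiableAt_of_contDiffOn hU (contDiffOn_pd hU hF 0) hp
  have h12 := differentiableAt_of_contDiffOn hU (contDiffOn_pd hU (contDiffOn_pd hU hF 2) 1) hp
  have h : Sre α F =ᶠ[nhds p] fun q => (Real.cos α * pd 0 F q + pd 1 (pd 2 F) q) / 4 := by
    filter_upwards [hU.mem_nhds hp] with q hq using Sre_eq hU hF hq
  rw [pd_congr h, pd_div_const ((h0.const_mul _).fun_add h12), pd_add (h0.const_mul _) h12,
    pd_const_mul h0]

theorem pd_Sim (hU : IsOpen U) (hF : ContDiffOn ℝ ∞ F U) {p : Pt} (hp : p ∈ U) (i : Fin 3) :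
    pd i (Sim α F) p = (pd i (pd 0 (pd 2 F)) p - Real.cos α * pd i (pd 1 F) p) / 4 := by
  have h1 := differentiableAt_of_contDiffOn hU (contDiffOn_pd hU hF 1) hp
  have h02 := differentiableAt_of_contDiffOn hU (contDiffOn_pd hU (contDiffOn_pd hU hF 2) 0) hp
  have h : Sim α F =ᶠ[nhds p] fun q => (pd 0 (pd 2 F) q - Real.cos α * pd 1 F q) / 4 := by
    filter_upwards [hU.mem_nhds hp] with q hq using Sim_eq hU hF hq
  rw [pd_congr h, pd_div_const (h02.fun_sub (h1.const_mul _)), pd_sub h02 (h1.const_mul _),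
    pd_const_mul h1]

theorem pd_quarterLaplacian (hU : IsOpen U) (hF : ContDiffOn ℝ ∞ F U) {p : Pt} (hp : p ∈ U)
    (i : Fin 3) : pd i (quarterLaplacian F) p =
      (pd i (pd 0 (pd 0 F)) p + pd i (pd 1 (pd 1 F)) p) / 4 := by
  have h0 := differentiableAt_of_contDiffOn hU (contDiffOn_pd hU (contDiffOn_pd hU hF 0) 0) hp
  have h1 := differentiableAt_of_contDiffOn hU (contDiffOn_pd hU (contDiffOn_pd hU hF 1) 1) hp
  unfold quarterLaplacian
  rw [pd_div_const (h0.fun_add h1), pd_add h0 h1]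

theorem pd_pd_pd_comm (hU : IsOpen U) (hF : ContDiffOn ℝ ∞ F U) {p : Pt} (hp : p ∈ U)
    (i j k : Fin 3) : pd i (pd j (pd k F)) p = pd k (pd i (pd j F)) p := by
  have h : pd j (pd k F) =ᶠ[nhds p] pd k (pd j F) := by
    filter_upwards [hU.mem_nhds hp] with q hq using pd_comm (hF.contDiffAt (hU.mem_nhds hq)) j k
  rw [pd_congr h, pd_comm ((contDiffOn_pd hU hF j).contDiffAt (hU.mem_nhds hp))]

/-- This identity and the next three use only the symmetry of partial derivatives of F, not the
field equation. The first three give the components of de³; the fourth says that ∂_y Re S + ∂_x Im S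
is the v-derivative of F_{ww̄}. -/
theorem pd_one_V (hU : IsOpen U) (hF : ContDiffOn ℝ ∞ F U) {p : Pt} (hp : p ∈ U) :
    pd 1 (V α F) p = pd 2 (Sre α F) p - Real.cos α * Sim α F p := by
  rw [pd_V hU hF hp, pd_Sre hU hF hp, Sim_eq hU hF hp,
    pd_comm (hF.contDiffAt (hU.mem_nhds hp)) 2 0,
    pd_comm ((contDiffOn_pd hU hF 2).contDiffAt (hU.mem_nhds hp)) 2 1]
  ring

theorem pd_zero_V (hU : IsOpen U) (hF : ContDiffOn ℝ ∞ F U) {p : Pt} (hp : p ∈ U) :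
    pd 0 (V α F) p = pd 2 (Sim α F) p + Real.cos α * Sre α F p := by
  rw [pd_V hU hF hp, pd_Sim hU hF hp, Sre_eq hU hF hp,
    pd_comm (hF.contDiffAt (hU.mem_nhds hp)) 2 1,
    pd_comm ((contDiffOn_pd hU hF 2).contDiffAt (hU.mem_nhds hp)) 2 0]
  ring

theorem pd_zero_Sre (hU : IsOpen U) (hF : ContDiffOn ℝ ∞ F U) {p : Pt} (hp : p ∈ U) :
    pd 0 (Sre α F) p = pd 1 (Sim α F) p + Real.cos α * quarterLaplacian F p := by
  rw [pd_Sre hU hF hp, pd_Sim hU hF hp, quarterLaplacian,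
    pd_comm ((contDiffOn_pd hU hF 2).contDiffAt (hU.mem_nhds hp)) 1 0]
  ring

theorem pd_one_Sre (hU : IsOpen U) (hF : ContDiffOn ℝ ∞ F U) {p : Pt} (hp : p ∈ U) :
    pd 1 (Sre α F) p = pd 2 (quarterLaplacian F) p - pd 0 (Sim α F) p := by
  rw [pd_Sre hU hF hp, pd_Sim hU hF hp, pd_quarterLaplacian hU hF hp,
    pd_comm (hF.contDiffAt (hU.mem_nhds hp)) 1 0,
    pd_pd_pd_comm hU hF hp 0 0 2, pd_pd_pd_comm hU hF hp 1 1 2]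
  ring

theorem pd_two_field_eq (hU : IsOpen U) (hF : ContDiffOn ℝ ∞ F U)
    (hEq : ∀ p ∈ U, FieldEquation α F p) {p : Pt} (hp : p ∈ U) :
    pd 2 (V α F) p * quarterLaplacian F p + V α F p * pd 2 (quarterLaplacian F) p
      - (2 * Sre α F p * pd 2 (Sre α F) p + 2 * Sim α F p * pd 2 (Sim α F) p)
      = -2 * Real.sin α * conf α p := by
  have hV := differentiableAt_of_contDiffOn hU (contDiffOn_V (α := α) hU hF) hp
  have ha := differentiableAt_of_contDiffOn hU (contDiffOn_Sre (α := α) hU hF) hp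
  have hb := differentiableAt_of_contDiffOn hU (contDiffOn_Sim (α := α) hU hF) hp
  have hL := differentiableAt_of_contDiffOn hU (contDiffOn_quarterLaplacian hU hF) hp
  have h : (fun q => V α F q * quarterLaplacian F q - (Sre α F q ^ 2 + Sim α F q ^ 2))
      =ᶠ[nhds p] conf α := by
    filter_upwards [hU.mem_nhds hp] with q hq using field_eq hU hF hq (hEq q hq)
  have h2 := pd_congr h 2
  rw [pd_conf, pd_sub (hV.fun_mul hL) ((ha.fun_pow 2).fun_add (hb.fun_pow 2)), pd_mul hV hL,
    pd_add (ha.fun_pow 2) (hb.fun_pow 2), pd_sq ha, pd_sq hb] at h2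
  simpa using h2

end FieldData

/-! ### Hodge duals and the vector field dual to e³. -/

section Duality

theorem star3_coframe {α : ℝ} {F : Pt → ℝ} {μ : Form3} {p : Pt} (hV : V α F p ≠ 0)
    (h₁ : ∀ i j k, μ p i j k = - μ p j i k) (h₂ : ∀ i j k, μ p i j k = - μ p i k j) :
    star3 (coframe α F) μ p = μ p 0 1 2 / (conf α p * V α F p) := by
  have hE := (conf_pos α p).ne'
  rw [star3_eq h₁ h₂, vol_eq, invMetric_eq α F hV, Matrix.det_fin_three]
  simp
  field_simp
  ring

theorem star1_skew (θ : Coframe) (β : Form1) (p : Pt) (j k : Fin 3) :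
    star1 θ β p j k = - star1 θ β p k j := by
  unfold star1
  simp only [← Finset.sum_neg_distrib]
  refine Finset.sum_congr rfl fun i _ => Finset.sum_congr rfl fun l _ => ?_
  rw [vol_skew₂]
  ring

theorem star1_coframe {α : ℝ} {F : Pt → ℝ} (β : Form1) {p : Pt} (hV : V α F p ≠ 0) :
    star1 (coframe α F) β p 0 1 = (conf α p * β p 2 - Sim α F p * (V α F p * β p 0 - Sim α F p * β p 2)
        - Sre α F p * (V α F p * β p 1 - Sre α F p * β p 2)) / V α F p ∧
      star1 (coframe α F) β p 0 2 = Sre α F p * β p 2 - V α F p * β p 1 ∧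
      star1 (coframe α F) β p 1 2 = V α F p * β p 0 - Sim α F p * β p 2 := by
  have hE := (conf_pos α p).ne'
  have hv := skew_eq (vol_skew₁ (coframe α F) p) (vol_skew₂ (coframe α F) p)
  unfold star1
  rw [hv, vol_eq, invMetric_eq α F hV]
  refine ⟨?_, ?_, ?_⟩ <;> simp [Fin.sum_univ_three] <;> field_simp <;> ring

theorem pd_neg (f : Pt → ℝ) (i : Fin 3) (p : Pt) : pd i (fun q => -f q) p = -pd i f p := by
  simp [pd, fderiv_fun_neg]

theorem d1_skew (β : Form1) (p : Pt) (i j : Fin 3) : d1 β p i j = - d1 β p j i := by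
  unfold d1; ring

theorem wedge12_skew₁ {β : Form1} {σ : Form2} {p : Pt} (h : ∀ i j, σ p i j = - σ p j i)
    (i j k : Fin 3) : wedge12 β σ p i j k = - wedge12 β σ p j i k := by
  unfold wedge12
  linear_combination β p i * h j k + β p j * h k i + β p k * h i j

theorem wedge12_skew₂ {β : Form1} {σ : Form2} {p : Pt} (h : ∀ i j, σ p i j = - σ p j i)
    (i j k : Fin 3) : wedge12 β σ p i j k = - wedge12 β σ p i k j := by
  unfold wedge12
  linear_combination β p i * h j k + β p j * h k i + β p k * h i j

theorem pd_skew {σ : Form2} (h : ∀ p i j, σ p i j = - σ p j i) (i j k : Fin 3) (p : Pt) :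
    pd i (fun q => σ q j k) p = - pd i (fun q => σ q k j) p := by
  rw [← pd_neg]; congr 1; funext q; exact h q j k

theorem d2_skew₁ {σ : Form2} (h : ∀ p i j, σ p i j = - σ p j i) (p : Pt)
    (i j k : Fin 3) : d2 σ p i j k = - d2 σ p j i k := by
  unfold d2
  linear_combination pd_skew h i j k p + pd_skew h j k i p + pd_skew h k i j p

theorem d2_skew₂ {σ : Form2} (h : ∀ p i j, σ p i j = - σ p j i) (p : Pt)
    (i j k : Fin 3) : d2 σ p i j k = - d2 σ p i k j := by
  unfold d2
  linear_combination pd_skew h i j k p + pd_skew h j k i p + pd_skew h k i j p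

theorem sharp_e3 {α : ℝ} {F : Pt → ℝ} {p : Pt} (hV : V α F p ≠ 0) :
    sharp (coframe α F) (e3 α F) p = ![0, 0, 1 / V α F p] := by
  have hE := (conf_pos α p).ne'
  funext i
  unfold sharp
  rw [invMetric_eq α F hV, e3_eq]
  fin_cases i <;> simp [Fin.sum_univ_three] <;> field_simp <;> ring

end Duality

/-! ### The twist and the divergence of e³. -/

section TwistDivergence

variable {α : ℝ} {U : Set Pt} {F : Pt → ℝ}

theorem twist_e3 (hU : IsOpen U) (hF : ContDiffOn ℝ ∞ F U) (hEq : ∀ p ∈ U, FieldEquation α F p)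
    {p : Pt} (hp : p ∈ U) : twist (coframe α F) (e3 α F) p = Real.cos α / V α F p := by
  have hV := V_ne_zero hU hF hp (hEq p hp)
  have hE := (conf_pos α p).ne'
  have h : wedge12 (e3 α F) (d1 (e3 α F)) p 0 1 2 =
      Sim α F p * (pd 1 (V α F) p - pd 2 (Sre α F) p)
        + Sre α F p * (pd 2 (Sim α F) p - pd 0 (V α F) p)
        + V α F p * (pd 0 (Sre α F) p - pd 1 (Sim α F) p) := by
    unfold wedge12 d1
    simp only [e3_eq, Matrix.cons_val]
  unfold twist
  rw [star3_coframe hV (wedge12_skew₁ (d1_skew _ _)) (wedge12_skew₂ (d1_skew _ _)), h,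
    pd_one_V hU hF hp, pd_zero_V hU hF hp, pd_zero_Sre hU hF hp]
  field_simp
  -- After substituting de³, the numerator is cos α (V F_{ww̄} - |S|²), which the field equation
  -- turns into cos α times the conformal factor.
  linear_combination Real.cos α * field_eq hU hF hp (hEq p hp)

theorem divergence_e3 (hU : IsOpen U) (hF : ContDiffOn ℝ ∞ F U)
    (hEq : ∀ p ∈ U, FieldEquation α F p) {p : Pt} (hp : p ∈ U) :
    divergence (coframe α F) (e3 α F) p = -2 * Real.sin α / V α F p := by
  have hV := V_ne_zero hU hF hp (hEq p hp)
  have hE := (conf_pos α p).ne'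
  -- The dual of e³ is e¹ ∧ e², that is, the conformal factor times dx ∧ dy. Equality is needed near
  -- `p` because it is differentiated next.
  have hs : ∀ j k, (fun q => star1 (coframe α F) (e3 α F) q j k) =ᶠ[nhds p]
      fun q => conf α q * ![![0, 1, 0], ![-1, 0, 0], ![0, 0, 0]] j k := by
    intro j k
    filter_upwards [hU.mem_nhds hp] with q hq
    have hVq := V_ne_zero hU hF hq (hEq q hq)
    obtain ⟨h01, h02, h12⟩ := star1_coframe (e3 α F) hVq
    have hd : ∀ i, star1 (coframe α F) (e3 α F) q i i = 0 := fun i => by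
      linarith [star1_skew (coframe α F) (e3 α F) q i i]
    rw [e3_eq] at h01 h02 h12
    have h10 := star1_skew (coframe α F) (e3 α F) q 1 0
    have h20 := star1_skew (coframe α F) (e3 α F) q 2 0
    have h21 := star1_skew (coframe α F) (e3 α F) q 2 1
    rw [h01] at h10; rw [h02] at h20; rw [h12] at h21
    fin_cases j <;> fin_cases k <;> simp [hd, h01, h02, h12, h10, h20, h21] <;> field_simp <;> ring
  unfold divergence
  rw [star3_coframe hV (d2_skew₁ (star1_skew _ _) p) (d2_skew₂ (star1_skew _ _) p)]
  unfold d2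
  rw [pd_congr (hs 1 2), pd_congr (hs 2 0), pd_congr (hs 0 1)]
  simp only [Matrix.cons_val, mul_zero, mul_one, pd_const]
  have := pd_conf α p 2
  simp only [if_true] at this
  change (0 + 0 + pd 2 (conf α) p) / _ = _
  rw [this]
  field_simp
  ring

end TwistDivergence

/-! ### The generalised monopole equation for constant multiples of 1/V. -/

section Monopole

variable {α : ℝ} {U : Set Pt} {F : Pt → ℝ}

theorem differentiableAt_div {f g : Pt → ℝ} {p : Pt} (hf : DifferentiableAt ℝ f p)
    (hg : DifferentiableAt ℝ g p) (h0 : g p ≠ 0) : DifferentiableAt ℝ (fun q => f q / g q) p := by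
  simpa only [div_eq_mul_inv] using hf.fun_mul (hg.fun_inv h0)

theorem solvesMonopole_of_eq_div (hU : IsOpen U) (hF : ContDiffOn ℝ ∞ F U)
    (hEq : ∀ p ∈ U, FieldEquation α F p) {T : Pt → ℝ} {k : ℝ}
    (hT : ∀ p ∈ U, T p = k / V α F p) : SolvesMonopole U (coframe α F) (nu α F) T := by
  have hV0 : ∀ p ∈ U, V α F p ≠ 0 := fun p hp => V_ne_zero hU hF hp (hEq p hp)
  have sV : ContDiffOn ℝ ∞ (V α F) U := contDiffOn_V hU hF
  have sa : ContDiffOn ℝ ∞ (Sre α F) U := contDiffOn_Sre hU hF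
  have sb : ContDiffOn ℝ ∞ (Sim α F) U := contDiffOn_Sim hU hF
  -- The potential is -k Re(S dw)/V. In the gauge with no dv component, the dx ∧ dv and dy ∧ dv
  -- components of the equation are exact v-derivatives, and integrating them gives these two
  -- coefficients.
  refine ⟨(contDiffOn_const.div sV hV0).congr hT,
    fun p => ![-k * (Sre α F p / V α F p), k * (Sim α F p / V α F p), 0], ?_, ?_⟩
  · rw [contDiffOn_pi]
    intro i
    fin_cases i
    · exact contDiffOn_const.mul (sa.div sV hV0)
    · exact contDiffOn_const.mul (sb.div sV hV0)
    · exact contDiffOn_const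
  · intro p hp
    have hV := hV0 p hp
    have dV := differentiableAt_of_contDiffOn hU sV hp
    have da := differentiableAt_of_contDiffOn hU sa hp
    have db := differentiableAt_of_contDiffOn hU sb hp
    have hd0 : ∀ i, d0 T p i = -k * pd i (V α F) p / V α F p ^ 2 := by
      intro i
      have h : T =ᶠ[nhds p] fun q => k / V α F q := by
        filter_upwards [hU.mem_nhds hp] with q hq using hT q hq
      unfold d0
      rw [pd_congr h, pd_div (by fun_prop) dV hV, pd_const]
      ring
    have ha : ∀ i, pd i (fun q => -k * (Sre α F q / V α F q)) p =
        -k * ((pd i (Sre α F) p * V α F p - Sre α F p * pd i (V α F) p) / V α F p ^ 2) := by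
      intro i; rw [pd_const_mul (differentiableAt_div da dV hV), pd_div da dV hV]
    have hb : ∀ i, pd i (fun q => k * (Sim α F q / V α F q)) p =
        k * ((pd i (Sim α F) p * V α F p - Sim α F p * pd i (V α F) p) / V α F p ^ 2) := by
      intro i; rw [pd_const_mul (differentiableAt_div db dV hV), pd_div db dV hV]
    set θ := coframe α F
    set β : Form1 := fun q i => d0 T q i + (1 / 2) * nu α F q i * T q
    have hβ : ∀ i, β p i = -k * pd i (V α F) p / V α F p ^ 2
        + (1 / 2) * nu α F p i * (k / V α F p) := fun i => by
      rw [← hd0, ← hT p hp]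
    obtain ⟨h01, h02, h12⟩ := star1_coframe β hV
    simp only [hβ, nu_eq, Matrix.cons_val, pd_one_V hU hF hp, pd_zero_V hU hF hp] at h01 h02 h12
    set A : Form1 := fun p => ![-k * (Sre α F p / V α F p), k * (Sim α F p / V α F p), 0] with hA
    have f := field_eq hU hF hp (hEq p hp)
    have fv := pd_two_field_eq hU hF hEq hp
    have k01 : star1 θ β p 0 1 = d1 A p 0 1 := by
      rw [h01]
      simp only [d1, hA, Matrix.cons_val, ha, hb, pd_one_V hU hF hp, pd_zero_V hU hF hp,
        pd_one_Sre hU hF hp]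
      field_simp
      -- The dx ∧ dy component contains V_v E and V E sin α: the field equation removes the first,
      -- its v-derivative the second.
      linear_combination 2 * (k * pd 2 (V α F) p) * f - 2 * (k * V α F p) * fv
    have k02 : star1 θ β p 0 2 = d1 A p 0 2 := by
      rw [h02]
      simp only [d1, hA, Matrix.cons_val, ha, pd_const]
      field_simp
      ring
    have k12 : star1 θ β p 1 2 = d1 A p 1 2 := by
      rw [h12]
      simp only [d1, hA, Matrix.cons_val, hb, pd_const]
      field_simp
      ring
    funext i j
    have hd : ∀ i, star1 θ β p i i = d1 A p i i := fun i => by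
      linarith [star1_skew θ β p i i, d1_skew A p i i]
    have sw : ∀ i j, star1 θ β p i j = d1 A p i j → star1 θ β p j i = d1 A p j i :=
      fun i j h => by rw [star1_skew, h, ← d1_skew]
    fin_cases i <;> fin_cases j
    exacts [hd 0, k01, k02, sw _ _ k01, hd 1, k12, sw _ _ k02, sw _ _ k12, hd 2]

end Monopole

/-! ### The Weyl derivative of the dual field: geodesic and shear-free properties. -/

section Congruence

variable {α : ℝ} {U : Set Pt} {F : Pt → ℝ}

theorem metric_comm (θ : Coframe) (p : Pt) (i j : Fin 3) : metric θ p i j = metric θ p j i := by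
  simp only [metric, Matrix.of_apply, mul_comm]

theorem sum_metric_mul_invMetric {p : Pt} (hV : V α F p ≠ 0) (f : Fin 3 → ℝ) (n : Fin 3) :
    ∑ i, metric (coframe α F) p n i * ∑ l, invMetric (coframe α F) p i l * f l = f n := by
  have h := congrFun (congrArg (fun M => M.mulVec f) (metric_mul_invMetric α F hV)) n
  simp only [← Matrix.mulVec_mulVec, Matrix.one_mulVec] at h
  exact h

/-- The Weyl derivative with its upper index lowered, for a multiple of `∂_v`. -/
theorem sum_metric_mul_weylD {ν : Form1} {W : VField} {p : Pt} (hV : V α F p ≠ 0) {g : Pt → ℝ}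
    (hW : W =ᶠ[nhds p] fun q => ![0, 0, g q]) (j n : Fin 3) :
    ∑ i, metric (coframe α F) p n i * weylD (coframe α F) ν W p j i =
      metric (coframe α F) p n 2 * pd j g p + g p *
        ((1 / 2) * (pd j (fun q => metric (coframe α F) q n 2) p
          + pd 2 (fun q => metric (coframe α F) q n j) p
          - pd n (fun q => metric (coframe α F) q j 2) p)
        - (1 / 2) * (metric (coframe α F) p n j * ν p 2 + metric (coframe α F) p n 2 * ν p j)
        + (1 / 2) * metric (coframe α F) p j 2 * ν p n) := by
  have hd : ∀ i, pd j (fun q => W q i) p = if i = 2 then pd j g p else 0 := by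
    intro i
    have h : (fun q => W q i) =ᶠ[nhds p] fun q => (![0, 0, g q] : Fin 3 → ℝ) i := by
      filter_upwards [hW] with q hq
      rw [hq]
    rw [pd_congr h]
    fin_cases i <;> simp [pd_const]
  -- Lowering the index cancels the inverse metric in both the Christoffel symbols and the Weyl
  -- correction, so only first derivatives of the metric remain.
  have h1 := sum_metric_mul_invMetric hV (fun l => pd j (fun q => metric (coframe α F) q l 2) p
    + pd 2 (fun q => metric (coframe α F) q l j) p
    - pd l (fun q => metric (coframe α F) q j 2) p) n
  have h2 := sum_metric_mul_invMetric hV (ν p) n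
  have hWp : W p = ![0, 0, g p] := hW.self_of_nhds
  have h3 : ∀ i, weylD (coframe α F) ν W p j i = (if i = 2 then pd j g p else 0) +
      (christoffel (coframe α F) p i j 2 + weylDiff (coframe α F) ν p i j 2) * g p := by
    intro i
    unfold weylD
    rw [hd, hWp]
    simp [Fin.sum_univ_three]
  have h4 : ∑ i, metric (coframe α F) p n i * (if i = 2 then pd j g p else 0) =
      metric (coframe α F) p n 2 * pd j g p := by simp
  have h5 : ∑ i, metric (coframe α F) p n i *
      ((if i = j then ν p 2 else 0) + (if i = 2 then ν p j else 0)) =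
      metric (coframe α F) p n j * ν p 2 + metric (coframe α F) p n 2 * ν p j := by
    simp [mul_add, Finset.sum_add_distrib]
  simp only [h3, christoffel, weylDiff]
  rw [← h4, ← h5, ← h2, ← h1]
  simp only [Finset.mul_sum, ← Finset.sum_add_distrib, ← Finset.sum_sub_distrib]
  simp only [Fin.sum_univ_three]
  ring

theorem pd_metric (hU : IsOpen U) (hF : ContDiffOn ℝ ∞ F U) {p : Pt} (hp : p ∈ U)
    (k i j : Fin 3) : pd k (fun q => metric (coframe α F) q i j) p =
      (if k = 2 then -2 * Real.sin α * conf α p * (![![1, 0, 0], ![0, 1, 0], ![0, 0, 0]] i j) else 0)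
      + ![pd k (Sim α F) p, pd k (Sre α F) p, pd k (V α F) p] i * e3 α F p j
      + e3 α F p i * ![pd k (Sim α F) p, pd k (Sre α F) p, pd k (V α F) p] j := by
  have dV := differentiableAt_of_contDiffOn hU (contDiffOn_V (α := α) hU hF) hp
  have da := differentiableAt_of_contDiffOn hU (contDiffOn_Sre (α := α) hU hF) hp
  have db := differentiableAt_of_contDiffOn hU (contDiffOn_Sim (α := α) hU hF) hp
  have dE := (differentiable_conf α) p
  simp only [metric_eq]
  rw [e3_eq]
  have hE : pd k (conf α) p = _ := pd_conf α p k
  fin_cases i <;> fin_cases j <;>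
    simp [pd_add dE (db.fun_pow 2), pd_add dE (da.fun_pow 2), pd_sq, da, db, dV, pd_mul, hE] <;>
    ring

theorem metric_eq_conf_add (p : Pt) (i j : Fin 3) : metric (coframe α F) p i j =
    conf α p * (![![1, 0, 0], ![0, 1, 0], ![0, 0, 0]] i j) + e3 α F p i * e3 α F p j := by
  rw [metric_eq, e3_eq]
  fin_cases i <;> fin_cases j <;> simp <;> ring

theorem sharp_e3_eventuallyEq (hU : IsOpen U) (hF : ContDiffOn ℝ ∞ F U)
    (hEq : ∀ p ∈ U, FieldEquation α F p) {p : Pt} (hp : p ∈ U) :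
    sharp (coframe α F) (e3 α F) =ᶠ[nhds p] fun q => ![0, 0, 1 / V α F q] := by
  filter_upwards [hU.mem_nhds hp] with q hq using sharp_e3 (V_ne_zero hU hF hq (hEq q hq))

theorem eq_of_sum_metric_mul_eq {p : Pt} (hV : V α F p ≠ 0) {u w : Fin 3 → ℝ}
    (h : ∀ n, ∑ i, metric (coframe α F) p n i * u i = ∑ i, metric (coframe α F) p n i * w i) :
    u = w := by
  have h1 : (metric (coframe α F) p).mulVec u = (metric (coframe α F) p).mulVec w := funext h
  have h2 := mul_eq_one_comm.1 (metric_mul_invMetric α F hV)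
  simpa [Matrix.mulVec_mulVec, h2] using congrArg (invMetric (coframe α F) p).mulVec h1

theorem pd_inv_V (hU : IsOpen U) (hF : ContDiffOn ℝ ∞ F U) (hEq : ∀ p ∈ U, FieldEquation α F p)
    {p : Pt} (hp : p ∈ U) (j : Fin 3) :
    pd j (fun q => 1 / V α F q) p = -pd j (V α F) p / V α F p ^ 2 := by
  simp only [one_div]
  exact pd_inv (differentiableAt_of_contDiffOn hU (contDiffOn_V hU hF) hp)
    (V_ne_zero hU hF hp (hEq p hp)) j

/-- The factor is forced: differentiating h(W, W) = 1 along W with D h = ν ⊗ h gives h(D_W W, W) =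
-ν(W)/2 = 2 sin α / V. That nothing transverse survives is due to the dx and dy components of ν
matching V_x and V_y. -/
theorem geodesic_sharp_e3 (hU : IsOpen U) (hF : ContDiffOn ℝ ∞ F U)
    (hEq : ∀ p ∈ U, FieldEquation α F p) {p : Pt} (hp : p ∈ U) :
    weylDAlong (coframe α F) (nu α F) (sharp (coframe α F) (e3 α F)) p
      (sharp (coframe α F) (e3 α F) p) =
    (2 * Real.sin α / V α F p) • sharp (coframe α F) (e3 α F) p := by
  have hV := V_ne_zero hU hF hp (hEq p hp)
  apply eq_of_sum_metric_mul_eq hV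
  intro n
  have h := sum_metric_mul_weylD (ν := nu α F) hV (sharp_e3_eventuallyEq hU hF hEq hp) 2 n
  have h1 : ∑ i, metric (coframe α F) p n i * weylDAlong (coframe α F) (nu α F)
      (sharp (coframe α F) (e3 α F)) p (sharp (coframe α F) (e3 α F) p) i =
      (1 / V α F p) * ∑ i, metric (coframe α F) p n i *
        weylD (coframe α F) (nu α F) (sharp (coframe α F) (e3 α F)) p 2 i := by
    rw [Finset.mul_sum]
    refine Finset.sum_congr rfl fun i _ => ?_
    have hW := sharp_e3 hV
    generalize sharp (coframe α F) (e3 α F) = W at hW ⊢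
    simp only [weylDAlong, hW, Fin.sum_univ_three, Matrix.cons_val]
    ring
  rw [h1, h, pd_inv_V hU hF hEq hp, sharp_e3 hV]
  simp only [pd_metric hU hF hp]
  simp only [metric_eq_conf_add, nu_eq, e3_eq, Fin.sum_univ_three]
  fin_cases n <;> simp [pd_one_V hU hF hp, pd_zero_V hU hF hp] <;> field_simp <;> ring

theorem inner_sharp_e3 {p : Pt} (hV : V α F p ≠ 0) (X : Fin 3 → ℝ) :
    inner (coframe α F) p X (sharp (coframe α F) (e3 α F) p) =
      Sim α F p * X 0 + Sre α F p * X 1 + V α F p * X 2 := by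
  unfold inner
  simp only [metric_eq_conf_add, e3_eq, sharp_e3 hV]
  simp [Fin.sum_univ_three]
  field_simp

theorem inner_weylDAlong (θ : Coframe) (ν : Form1) (W : VField) (p : Pt) (X Y : Fin 3 → ℝ) :
    inner θ p (weylDAlong θ ν W p X) Y =
      ∑ n, ∑ j, Y n * X j * ∑ i, metric θ p n i * weylD θ ν W p j i := by
  unfold inner weylDAlong
  simp only [Fin.sum_univ_three, metric_comm θ p 1 0, metric_comm θ p 2 0, metric_comm θ p 2 1]
  ring

/-- For X and Y annihilated by e³, the derivatives of V and S cancel. The conformal factor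
contributes -2 sin α / V and the term -ν(W) contributes 4 sin α / V, both multiplying h(X, Y). -/
theorem shear_free_sharp_e3 (hU : IsOpen U) (hF : ContDiffOn ℝ ∞ F U)
    (hEq : ∀ p ∈ U, FieldEquation α F p) {p : Pt} (hp : p ∈ U) (X Y : Fin 3 → ℝ)
    (hX : inner (coframe α F) p X (sharp (coframe α F) (e3 α F) p) = 0)
    (hY : inner (coframe α F) p Y (sharp (coframe α F) (e3 α F) p) = 0) :
    inner (coframe α F) p (weylDAlong (coframe α F) (nu α F)
        (sharp (coframe α F) (e3 α F)) p X) Y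
      + inner (coframe α F) p (weylDAlong (coframe α F) (nu α F)
        (sharp (coframe α F) (e3 α F)) p Y) X =
    (2 * Real.sin α / V α F p) * inner (coframe α F) p X Y := by
  have hV := V_ne_zero hU hF hp (hEq p hp)
  rw [inner_sharp_e3 hV] at hX hY
  -- Orthogonality to W is solved for the v-component, so that the x- and y-components become free
  -- parameters of a polynomial identity.
  have hX2 : X 2 = -(Sim α F p * X 0 + Sre α F p * X 1) / V α F p := by
    field_simp; linarith
  have hY2 : Y 2 = -(Sim α F p * Y 0 + Sre α F p * Y 1) / V α F p := by
    field_simp; linarith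
  rw [inner_weylDAlong, inner_weylDAlong]
  simp only [sum_metric_mul_weylD hV (sharp_e3_eventuallyEq hU hF hEq hp), pd_inv_V hU hF hEq hp]
  unfold inner
  simp only [pd_metric hU hF hp]
  simp only [metric_eq_conf_add, nu_eq, e3_eq, Fin.sum_univ_three, hX2, hY2]
  simp
  field_simp
  ring

theorem isShearFreeGeodesicCongruence_sharp_e3 (hU : IsOpen U) (hF : ContDiffOn ℝ ∞ F U)
    (hEq : ∀ p ∈ U, FieldEquation α F p) :
    IsShearFreeGeodesicCongruence U (coframe α F) (nu α F) (sharp (coframe α F) (e3 α F)) where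
  smooth := by
    have h : ContDiffOn ℝ ∞ (fun q => (![0, 0, 1 / V α F q] : Fin 3 → ℝ)) U := by
      rw [contDiffOn_pi]
      intro i
      fin_cases i
      · exact contDiffOn_const
      · exact contDiffOn_const
      · exact contDiffOn_const.div (contDiffOn_V hU hF) fun p hp => V_ne_zero hU hF hp (hEq p hp)
    exact h.congr fun p hp => sharp_e3 (V_ne_zero hU hF hp (hEq p hp))
  ne_zero p hp h := by
    have hV := V_ne_zero hU hF hp (hEq p hp)
    rw [sharp_e3 hV] at h
    simpa [hV] using congrFun h 2
  geodesic p hp := ⟨_, geodesic_sharp_e3 hU hF hEq hp⟩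
  shear_free p hp := ⟨_, shear_free_sharp_e3 hU hF hEq hp⟩

end Congruence

end EW

theorem mainTheorem8 (α : ℝ) (U : Set EW.Pt) (hU : IsOpen U) (F : EW.Pt → ℝ)
    (hF : ContDiffOn ℝ ∞ F U) (hEq : ∀ p ∈ U, EW.FieldEquation α F p) :
    EW.IsShearFreeGeodesicCongruence U (EW.coframe α F) (EW.nu α F)
        (EW.sharp (EW.coframe α F) (EW.e3 α F)) ∧
      (∀ p ∈ U, EW.V α F p ≠ 0 ∧
        EW.twist (EW.coframe α F) (EW.e3 α F) p = Real.cos α / EW.V α F p ∧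
        EW.divergence (EW.coframe α F) (EW.e3 α F) p = -2 * Real.sin α / EW.V α F p) ∧
      (Real.sin α ≠ 0 → ∃ c : ℝ, ∀ p ∈ U,
        EW.twist (EW.coframe α F) (EW.e3 α F) p
          = c * EW.divergence (EW.coframe α F) (EW.e3 α F) p) ∧
      (Real.cos α ≠ 0 → ∃ c : ℝ, ∀ p ∈ U,
        EW.divergence (EW.coframe α F) (EW.e3 α F) p
          = c * EW.twist (EW.coframe α F) (EW.e3 α F) p) ∧
      EW.SolvesMonopole U (EW.coframe α F) (EW.nu α F)
        (EW.twist (EW.coframe α F) (EW.e3 α F)) ∧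
      EW.SolvesMonopole U (EW.coframe α F) (EW.nu α F)
        (EW.divergence (EW.coframe α F) (EW.e3 α F)) := by
  have hV := fun p (hp : p ∈ U) => EW.V_ne_zero hU hF hp (hEq p hp)
  have ht := fun p (hp : p ∈ U) => EW.twist_e3 hU hF hEq hp
  have hd := fun p (hp : p ∈ U) => EW.divergence_e3 hU hF hEq hp
  refine ⟨EW.isShearFreeGeodesicCongruence_sharp_e3 hU hF hEq,
    fun p hp => ⟨hV p hp, ht p hp, hd p hp⟩,
    fun hs => ⟨-Real.cos α / (2 * Real.sin α), fun p hp => ?_⟩,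
    fun hc => ⟨-(2 * Real.sin α) / Real.cos α, fun p hp => ?_⟩,
    EW.solvesMonopole_of_eq_div hU hF hEq ht, EW.solvesMonopole_of_eq_div hU hF hEq hd⟩
  · have := hV p hp
    rw [ht p hp, hd p hp]
    field_simp
  · have := hV p hp
    rw [ht p hp, hd p hp]
    field_simp
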